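/- Let $n\ge 0$ be an integer and $\alpha>0$. Let $\mathcal F^2_\alpha(\mathbb C^n)$ be the Fock space of all holomorphic functions $f:\mathbb C^n\to\mathbb C$ with $$\|f\|_\alpha^2=\int_{\mathbb C^n}|f(z)|^2\,\Bigl(\frac{\alpha}{\pi}\Bigr)^n e^{-\alpha|z|^2}\,dv(z)<\infty,$$ where $dv$ is Lebesgue measure on $\mathbb C^n$; it is a Hilbert space with inner product $\langle f,g\rangle_\alpha=\int_{\mathbb C^n} f(z)\overline{g(z)}\,(\alpha/\pi)^n e^{-\alpha|z|^2}\,dv(z)$. (The classical Fock space $\mathcal F^2(\mathbb C^n)$ is the case $\alpha=1/2$.) Let $\varphi:\mathbb C^n\to\mathbb C^n$ be a holomorphic mapping such that the composition operator $C_\varphi f=f\circ\varphi$ is bounded on $\mathcal F^2_\alpha(\mathbb C^n)$. Then $C_\varphi$ is essentially normal, i.e. the self-commutator $C_\varphi^*C_\varphi-C_\varphi C_\varphi^*$ is compact, if and only if $C_\varphi$ is compact or normal (or both). -/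

import Mathlib

open MeasureTheory

noncomputable section

/-- The Gaussian measure `(α/π)ⁿ exp(-α |z|²) dv(z)` on `ℂⁿ`. -/
def gaussianMeasure (n : ℕ) (α : ℝ) : Measure (EuclideanSpace ℂ (Fin n)) :=
  volume.withDensity fun z ↦ ENNReal.ofReal ((α / Real.pi) ^ n * Real.exp (-α * ‖z‖ ^ 2))

/-- The entire functions on `ℂⁿ` that are square integrable for the Gaussian measure, as a
space of functions. -/
def fockSubmodule (n : ℕ) (α : ℝ) : Submodule ℂ (EuclideanSpace ℂ (Fin n) → ℂ) where
  carrier := {f | Differentiable ℂ f ∧ MemLp f 2 (gaussianMeasure n α)}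
  add_mem' hf hg := ⟨hf.1.add hg.1, hf.2.add hg.2⟩
  zero_mem' := ⟨differentiable_const _, MemLp.zero⟩
  smul_mem' c _ hf := ⟨hf.1.const_smul c, hf.2.const_smul c⟩

/-- The Fock space `F²_α(ℂⁿ)`. -/
def FockSpace (n : ℕ) (α : ℝ) : Type := ↥(fockSubmodule n α)

namespace FockSpace

variable {n : ℕ} {α : ℝ}

instance : AddCommGroup (FockSpace n α) := inferInstanceAs (AddCommGroup ↥(fockSubmodule n α))

instance : Module ℂ (FockSpace n α) := inferInstanceAs (Module ℂ ↥(fockSubmodule n α))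

instance : FunLike (FockSpace n α) (EuclideanSpace ℂ (Fin n)) ℂ where
  coe f := f.1
  coe_injective _ _ h := Subtype.ext h

/-- The element of the Fock space given by a square integrable entire function. -/
def mk (f : EuclideanSpace ℂ (Fin n) → ℂ) (hf : Differentiable ℂ f)
    (hL : MemLp f 2 (gaussianMeasure n α)) : FockSpace n α :=
  ⟨f, ⟨hf, hL⟩⟩

@[simp] theorem mk_apply (f : EuclideanSpace ℂ (Fin n) → ℂ) (hf : Differentiable ℂ f)
    (hL : MemLp f 2 (gaussianMeasure n α)) (z) : mk f hf hL z = f z := rfl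

@[ext] theorem ext {f g : FockSpace n α} (h : ∀ z, f z = g z) : f = g := DFunLike.ext _ _ h

@[simp] theorem add_apply (f g : FockSpace n α) (z) : (f + g) z = f z + g z := rfl

@[simp] theorem smul_apply (c : ℂ) (f : FockSpace n α) (z) : (c • f) z = c * f z := rfl

@[simp] theorem zero_apply (z) : (0 : FockSpace n α) z = 0 := rfl

@[simp] theorem sub_apply (f g : FockSpace n α) (z) : (f - g) z = f z - g z := rfl

theorem differentiable (f : FockSpace n α) : Differentiable ℂ f := f.2.1

theorem memLp (f : FockSpace n α) : MemLp f 2 (gaussianMeasure n α) := f.2.2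

theorem integrable_conj_mul (f g : FockSpace n α) :
    Integrable (fun z ↦ starRingEnd ℂ (f z) * g z) (gaussianMeasure n α) :=
  f.memLp.star.integrable_mul g.memLp

theorem gaussianMeasure_density_pos (hα : 0 < α) (z : EuclideanSpace ℂ (Fin n)) :
    0 < (α / Real.pi) ^ n * Real.exp (-α * ‖z‖ ^ 2) := by
  have := Real.pi_pos
  positivity

theorem volume_absolutelyContinuous (hα : 0 < α) :
    (volume : Measure (EuclideanSpace ℂ (Fin n))) ≪ gaussianMeasure n α := by
  refine withDensity_absolutelyContinuous' ?_ ?_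
  · fun_prop
  · refine Filter.Eventually.of_forall fun z ↦ ?_
    simpa using gaussianMeasure_density_pos hα z

theorem integral_gaussianMeasure (hα : 0 < α) (F : EuclideanSpace ℂ (Fin n) → ℝ) :
    ∫ z, F z ∂(gaussianMeasure n α)
      = ∫ z, ((α / Real.pi) ^ n * Real.exp (-α * ‖z‖ ^ 2)) * F z := by
  rw [gaussianMeasure, integral_withDensity_eq_integral_toReal_smul (by fun_prop) (by simp)]
  refine integral_congr_ae (Filter.Eventually.of_forall fun z ↦ ?_)
  simp [ENNReal.toReal_ofReal (gaussianMeasure_density_pos hα z).le, -neg_mul]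

variable [hα : Fact (0 < α)]

/-- The inner product `∫ conj f · g dv_α` (conjugate linear in the first argument, as in
Mathlib). -/
abbrev core : InnerProductSpace.Core ℂ (FockSpace n α) where
  inner f g := ∫ z, starRingEnd ℂ (f z) * g z ∂(gaussianMeasure n α)
  conj_inner_symm f g := by
    rw [← integral_conj]
    simp [mul_comm]
  re_inner_nonneg f := by
    have : (∫ z, starRingEnd ℂ (f z) * f z ∂(gaussianMeasure n α))
        = ((∫ z, ‖f z‖ ^ 2 ∂(gaussianMeasure n α) : ℝ) : ℂ) := by
      rw [← integral_complex_ofReal]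
      simp [RCLike.conj_mul]
    rw [this]
    simp only [RCLike.re_to_complex, Complex.ofReal_re]
    positivity
  add_left f g h := by
    rw [← integral_add (integrable_conj_mul f h) (integrable_conj_mul g h)]
    simp [add_mul]
  smul_left f g c := by
    rw [← integral_const_mul]
    simp [mul_assoc]
  definite f hf := by
    have h1 : (∫ z, starRingEnd ℂ (f z) * f z ∂(gaussianMeasure n α))
        = ((∫ z, ‖f z‖ ^ 2 ∂(gaussianMeasure n α) : ℝ) : ℂ) := by
      rw [← integral_complex_ofReal]
      simp [RCLike.conj_mul]
    have h2 : (∫ z, ‖f z‖ ^ 2 ∂(gaussianMeasure n α)) = 0 := by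
      have := h1.symm.trans hf
      exact_mod_cast this
    rw [integral_eq_zero_iff_of_nonneg (fun z ↦ by positivity) f.memLp.norm.integrable_sq] at h2
    have h3 := (volume_absolutelyContinuous hα.out).ae_le h2
    have h4 : (fun z ↦ ‖f z‖ ^ 2) = fun _ ↦ (0 : ℝ) :=
      Continuous.ae_eq_iff_eq volume (by have := f.differentiable.continuous; fun_prop)
        continuous_const |>.1 h3
    ext z
    simpa using congrFun h4 z

instance : NormedAddCommGroup (FockSpace n α) :=
  @InnerProductSpace.Core.toNormedAddCommGroup ℂ (FockSpace n α) _ _ _ core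

instance : InnerProductSpace ℂ (FockSpace n α) := InnerProductSpace.ofCore core.toCore

theorem inner_def (f g : FockSpace n α) :
    inner ℂ f g = ∫ z, starRingEnd ℂ (f z) * g z ∂(gaussianMeasure n α) := rfl

theorem norm_sq_eq (f : FockSpace n α) :
    ‖f‖ ^ 2 = ∫ z, ‖f z‖ ^ 2 ∂(gaussianMeasure n α) := by
  have h : ((‖f‖ ^ 2 : ℝ) : ℂ) = ((∫ z, ‖f z‖ ^ 2 ∂(gaussianMeasure n α) : ℝ) : ℂ) := by
    rw [← integral_complex_ofReal]
    have := inner_self_eq_norm_sq_to_K (𝕜 := ℂ) f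
    rw [inner_def] at this
    simp only [Complex.ofReal_pow]
    refine this.symm.trans ?_
    simp [RCLike.conj_mul]
  exact_mod_cast h

/-- Mean value property of entire functions over closed unit balls. -/
theorem setIntegral_closedBall_eq {f : EuclideanSpace ℂ (Fin n) → ℂ} (hf : Differentiable ℂ f)
    (p : EuclideanSpace ℂ (Fin n)) :
    ∫ w in Metric.closedBall (0 : EuclideanSpace ℂ (Fin n)) 1, f (p + w)
      = (volume : Measure (EuclideanSpace ℂ (Fin n))).real (Metric.closedBall 0 1) * f p := by
  set B := Metric.closedBall (0 : EuclideanSpace ℂ (Fin n)) 1 with hB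
  have hBc : IsCompact B := isCompact_closedBall _ _
  have hfc := hf.continuous
  have rot : ∀ θ : ℝ, ∫ w in B, f (p + Complex.exp (θ * Complex.I) • w) = ∫ w in B, f (p + w) := by
    intro θ
    let L : EuclideanSpace ℂ (Fin n) ≃ₗᵢ[ℝ] EuclideanSpace ℂ (Fin n) :=
      { (LinearEquiv.smulOfNeZero ℂ (EuclideanSpace ℂ (Fin n)) (Complex.exp (θ * Complex.I))
          (Complex.exp_ne_zero _)).restrictScalars ℝ with
        norm_map' := fun w ↦ by
          change ‖Complex.exp (θ * Complex.I) • w‖ = ‖w‖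
          simp [norm_smul, Complex.norm_exp_ofReal_mul_I] }
    have hL : ∀ w, L w = Complex.exp (θ * Complex.I) • w := fun w ↦ rfl
    have := L.measurePreserving.setIntegral_preimage_emb
      L.toHomeomorph.measurableEmbedding (fun w ↦ f (p + w)) B
    have hpre : L ⁻¹' B = B := by
      ext w
      simp [hB]
    rw [hpre] at this
    simpa only [hL] using this
  have mv : ∀ w, (∫ θ in (0 : ℝ)..2 * Real.pi, f (p + Complex.exp (θ * Complex.I) • w))
      = 2 * Real.pi * f p := by
    intro w
    have h := DiffContOnCl.circleAverage (f := fun t : ℂ ↦ f (p + t • w)) (c := 0) (R := 1)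
      (by
        have : Differentiable ℂ fun t : ℂ ↦ f (p + t • w) :=
          hf.comp (by fun_prop)
        exact this.diffContOnCl)
    rw [Real.circleAverage_def] at h
    simp only [circleMap, zero_smul, add_zero, zero_add, Complex.ofReal_one, one_mul] at h
    rw [← h]
    simp only [Complex.real_smul]
    push_cast
    rw [mul_inv_cancel_left₀ (by simp)]
  have swap : ∫ θ in (0 : ℝ)..2 * Real.pi, ∫ w in B, f (p + Complex.exp (θ * Complex.I) • w)
      = ∫ w in B, ∫ θ in (0 : ℝ)..2 * Real.pi, f (p + Complex.exp (θ * Complex.I) • w) := by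
    refine intervalIntegral_integral_swap ?_
    rw [Measure.prod_restrict]
    refine IntegrableOn.mono_set (t := Set.Icc 0 (2 * Real.pi) ×ˢ B) ?_
      (Set.prod_mono (by
        rw [Set.uIoc_of_le (by positivity)]; exact Set.Ioc_subset_Icc_self) subset_rfl)
    refine ContinuousOn.integrableOn_compact (isCompact_Icc.prod hBc) ?_
    apply Continuous.continuousOn
    simp only [Function.uncurry_def]
    fun_prop
  simp only [rot, mv] at swap
  rw [intervalIntegral.integral_const, setIntegral_const] at swap
  simp only [Complex.real_smul, sub_zero] at swap
  push_cast at swap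
  have h2 : (2 * Real.pi : ℂ) ≠ 0 := by simp
  apply mul_left_cancel₀ h2
  rw [swap]
  ring

/-- Point evaluations are bounded on the Fock space, uniformly on bounded sets. -/
theorem exists_norm_apply_le (n : ℕ) (α : ℝ) [Fact (0 < α)] (R : ℝ) :
    ∃ K : ℝ, 0 ≤ K ∧ ∀ (f : FockSpace n α) (p : EuclideanSpace ℂ (Fin n)), ‖p‖ ≤ R →
      ‖f p‖ ≤ K * ‖f‖ := by
  have hα' : 0 < α := Fact.out
  set V := (volume : Measure (EuclideanSpace ℂ (Fin n))).real (Metric.closedBall 0 1) with hV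
  have hVpos : 0 < V := by
    refine ENNReal.toReal_pos ?_ ?_
    · exact (Metric.measure_closedBall_pos volume 0 one_pos).ne'
    · exact (isCompact_closedBall _ _).measure_lt_top.ne
  set c := (α / Real.pi) ^ n * Real.exp (-α * (R + 1) ^ 2) with hc
  have hcpos : 0 < c := by
    have := Real.pi_pos
    positivity
  refine ⟨Real.sqrt (1 / (V * c)), Real.sqrt_nonneg _, fun f p hp ↦ ?_⟩
  have hfc := f.differentiable.continuous
  have key : V * c * ‖f p‖ ^ 2 ≤ ‖f‖ ^ 2 := by
    have h1 := setIntegral_closedBall_eq (f := fun z ↦ f z ^ 2) (f.differentiable.pow 2) p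
    have h2 : V * ‖f p‖ ^ 2
        ≤ ∫ w in Metric.closedBall (0 : EuclideanSpace ℂ (Fin n)) 1, ‖f (p + w)‖ ^ 2 := by
      have := norm_integral_le_integral_norm (μ := volume.restrict
        (Metric.closedBall (0 : EuclideanSpace ℂ (Fin n)) 1)) (fun w ↦ f (p + w) ^ 2)
      rw [h1] at this
      simpa [abs_of_pos hVpos, ← hV] using this
    have hint : Integrable fun z : EuclideanSpace ℂ (Fin n) ↦
        ((α / Real.pi) ^ n * Real.exp (-α * ‖z‖ ^ 2)) * ‖f z‖ ^ 2 := by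
      have h := f.memLp.norm.integrable_sq
      rw [gaussianMeasure, integrable_withDensity_iff (by fun_prop) (by simp)] at h
      refine h.congr (Filter.Eventually.of_forall fun z ↦ ?_)
      simp only [ENNReal.toReal_ofReal (gaussianMeasure_density_pos hα' z).le]
      ring
    rw [norm_sq_eq, integral_gaussianMeasure hα', ← integral_add_left_eq_self _ p]
    have hint' := hint.comp_add_left p
    calc V * c * ‖f p‖ ^ 2 = c * (V * ‖f p‖ ^ 2) := by ring
      _ ≤ c * ∫ w in Metric.closedBall (0 : EuclideanSpace ℂ (Fin n)) 1, ‖f (p + w)‖ ^ 2 := by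
        gcongr
      _ = ∫ w in Metric.closedBall (0 : EuclideanSpace ℂ (Fin n)) 1, c * ‖f (p + w)‖ ^ 2 := by
        rw [integral_const_mul]
      _ ≤ ∫ w in Metric.closedBall (0 : EuclideanSpace ℂ (Fin n)) 1,
          ((α / Real.pi) ^ n * Real.exp (-α * ‖p + w‖ ^ 2)) * ‖f (p + w)‖ ^ 2 := by
        refine setIntegral_mono_on ?_ hint'.integrableOn measurableSet_closedBall ?_
        · refine ContinuousOn.integrableOn_compact (isCompact_closedBall _ _) ?_
          apply Continuous.continuousOn
          fun_prop
        · intro w hw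
          have hw' : ‖w‖ ≤ 1 := by simpa using hw
          have h3 : ‖p + w‖ ≤ R + 1 := (norm_add_le _ _).trans (by linarith)
          have h4 : ‖p + w‖ ^ 2 ≤ (R + 1) ^ 2 := by gcongr
          have h5 : 0 < α / Real.pi := div_pos hα' Real.pi_pos
          have h6 : -α * (R + 1) ^ 2 ≤ -α * ‖p + w‖ ^ 2 := by nlinarith
          rw [hc]
          gcongr
      _ ≤ _ := by
        refine setIntegral_le_integral hint' (Filter.Eventually.of_forall fun w ↦ ?_)
        have := (gaussianMeasure_density_pos (n := n) hα' (p + w)).le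
        simp only [Pi.zero_apply]
        positivity
  have hVc : 0 < V * c := mul_pos hVpos hcpos
  refine abs_le_of_sq_le_sq' ?_ (by positivity) |>.2
  rw [mul_pow, Real.sq_sqrt (by positivity), one_div, ← div_eq_inv_mul, le_div_iff₀ hVc]
  linarith

/-- Derivatives are bounded on the Fock space, uniformly on bounded sets. -/
theorem exists_norm_fderiv_le (n : ℕ) (α : ℝ) [Fact (0 < α)] (R : ℝ) :
    ∃ K : ℝ, 0 ≤ K ∧ ∀ (f : FockSpace n α) (p : EuclideanSpace ℂ (Fin n)), ‖p‖ ≤ R →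
      ‖fderiv ℂ f p‖ ≤ K * ‖f‖ := by
  obtain ⟨K, hK, h⟩ := exists_norm_apply_le n α (R + 1)
  refine ⟨K, hK, fun f p hp ↦ ?_⟩
  refine ContinuousLinearMap.opNorm_le_of_unit_norm (by positivity) fun v hv ↦ ?_
  have hd : HasDerivAt (fun t : ℂ ↦ p + t • v) v 0 := by
    simpa using ((hasDerivAt_id (0 : ℂ)).smul_const v).const_add p
  have h1 : HasDerivAt (fun t : ℂ ↦ f (p + t • v)) (fderiv ℂ f p v) 0 := by
    have h0 : HasFDerivAt f (fderiv ℂ f p) (p + (0 : ℂ) • v) := by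
      simpa using (f.differentiable p).hasFDerivAt
    exact h0.comp_hasDerivAt 0 hd
  rw [← h1.deriv, ← div_one (K * ‖f‖)]
  refine Complex.norm_deriv_le_of_forall_mem_sphere_norm_le one_pos ?_ fun t ht ↦ ?_
  · have : Differentiable ℂ fun t : ℂ ↦ f (p + t • v) :=
      f.differentiable.comp (by fun_prop)
    exact this.diffContOnCl
  · refine h f _ ((norm_add_le _ _).trans ?_)
    have : ‖t‖ = 1 := by simpa using ht
    rw [norm_smul, this, hv]
    linarith

/-- The canonical isometric embedding into `L²`. -/
def toL2 (n : ℕ) (α : ℝ) [Fact (0 < α)] :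
    FockSpace n α →ₗᵢ[ℂ] Lp ℂ 2 (gaussianMeasure n α) where
  toFun f := f.memLp.toLp f
  map_add' f g := MemLp.toLp_add f.memLp g.memLp
  map_smul' c f := MemLp.toLp_const_smul c f.memLp
  norm_map' f := by
    have h : ‖f.memLp.toLp f‖ ^ 2 = ‖f‖ ^ 2 := by
      have hae : (fun z ↦ ‖f.memLp.toLp f z‖ ^ 2) =ᵐ[gaussianMeasure n α] fun z ↦ ‖f z‖ ^ 2 :=
        f.memLp.coeFn_toLp.fun_comp fun z ↦ ‖z‖ ^ 2
      rw [norm_sq_eq, ← integral_congr_ae hae]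
      have := inner_self_eq_norm_sq_to_K (𝕜 := ℂ) (f.memLp.toLp f)
      rw [L2.inner_def] at this
      simp only [inner_self_eq_norm_sq_to_K] at this
      have h2 : ((∫ z, ‖f.memLp.toLp f z‖ ^ 2 ∂(gaussianMeasure n α) : ℝ) : ℂ)
          = ((‖f.memLp.toLp f‖ ^ 2 : ℝ) : ℂ) := by
        rw [← integral_complex_ofReal]
        simpa using this
      exact_mod_cast h2.symm
    exact (sq_eq_sq₀ (norm_nonneg _) (norm_nonneg _)).1 h

/-- The Fock space is a Hilbert space. -/
instance : CompleteSpace (FockSpace n α) := by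
  refine Metric.complete_of_cauchySeq_tendsto fun u hu ↦ ?_
  have cauchy_of : ∀ {G : Type} [NormedAddCommGroup G] (e : FockSpace n α → G) (K : ℝ),
      (∀ f g, ‖e f - e g‖ ≤ K * ‖f - g‖) → CauchySeq fun k ↦ e (u k) := by
    intro G _ e K he
    have : LipschitzWith K.toNNReal e := LipschitzWith.of_dist_le_mul fun f g ↦ by
      rw [dist_eq_norm, dist_eq_norm]
      exact (he f g).trans (by gcongr; exact Real.le_coe_toNNReal K)
    exact hu.map this.uniformContinuous
  have fderiv_sub' : ∀ (f g : FockSpace n α) z,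
      fderiv ℂ f z - fderiv ℂ g z = fderiv ℂ (f - g : FockSpace n α) z := fun f g z ↦
    (fderiv_sub (f.differentiable z) (g.differentiable z)).symm
  -- pointwise limits
  have lim : ∀ z, ∃ a, Filter.Tendsto (fun k ↦ u k z) Filter.atTop (nhds a) := fun z ↦ by
    obtain ⟨K, _, h⟩ := exists_norm_apply_le n α ‖z‖
    exact cauchySeq_tendsto_of_complete
      (cauchy_of (fun f ↦ f z) K fun f g ↦ by simpa using h (f - g) z le_rfl)
  choose g hg using lim
  have lim' : ∀ z, ∃ a, Filter.Tendsto (fun k ↦ fderiv ℂ (u k) z) Filter.atTop (nhds a) :=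
    fun z ↦ by
      obtain ⟨K, _, h⟩ := exists_norm_fderiv_le n α ‖z‖
      exact cauchySeq_tendsto_of_complete
        (cauchy_of (fun f ↦ fderiv ℂ f z) K fun f g ↦ by
          simpa only [fderiv_sub'] using h (f - g) z le_rfl)
  choose g' hg' using lim'
  have hgd : Differentiable ℂ g := fun x ↦ by
    obtain ⟨K, hK, h⟩ := exists_norm_fderiv_le n α (‖x‖ + 1)
    have hunif : TendstoUniformlyOn (fun k z ↦ fderiv ℂ (u k) z) g' Filter.atTop
        (Metric.ball x 1) := by
      refine UniformCauchySeqOn.tendstoUniformlyOn_of_tendsto ?_ fun z _ ↦ hg' z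
      rw [Metric.uniformCauchySeqOn_iff]
      intro ε hε
      obtain ⟨N, hN⟩ := Metric.cauchySeq_iff.1 hu (ε / (K + 1)) (by positivity)
      refine ⟨N, fun k hk l hl z hz ↦ ?_⟩
      have hz' : ‖z‖ ≤ ‖x‖ + 1 := by
        have h1 : ‖z - x‖ < 1 := by simpa [dist_eq_norm] using hz
        have h2 := norm_add_le x (z - x)
        rw [add_sub_cancel] at h2
        linarith
      have h3 := hN k hk l hl
      rw [dist_eq_norm, lt_div_iff₀ (by positivity)] at h3
      rw [dist_eq_norm, fderiv_sub']
      have h4 := norm_nonneg (u k - u l)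
      have h5 := h (u k - u l) z hz'
      nlinarith
    exact (hasFDerivAt_of_tendstoLocallyUniformlyOn Metric.isOpen_ball
      hunif.tendstoLocallyUniformlyOn
      (fun k z _ ↦ ((u k).differentiable z).hasFDerivAt) (fun z _ ↦ hg z)
      (Metric.mem_ball_self one_pos)).differentiableAt
  -- the `L²` limit
  obtain ⟨v, hv⟩ := cauchySeq_tendsto_of_complete
    
    (show CauchySeq fun k ↦ toL2 n α (u k) from
      UniformContinuous.comp_cauchySeq (toL2 n α).isometry.uniformContinuous hu)
  obtain ⟨ns, hns, hae⟩ := (tendstoInMeasure_of_tendsto_Lp hv).exists_seq_tendsto_ae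
  have hvg : (v : EuclideanSpace ℂ (Fin n) → ℂ) =ᵐ[gaussianMeasure n α] g := by
    have hall : ∀ᵐ z ∂(gaussianMeasure n α), ∀ k, (toL2 n α (u k)) z = u k z :=
      ae_all_iff.2 fun k ↦ (u k).memLp.coeFn_toLp
    filter_upwards [hae, hall] with z hz1 hz2
    simp only [hz2] at hz1
    exact tendsto_nhds_unique hz1 ((hg z).comp hns.tendsto_atTop)
  have hgL : MemLp g 2 (gaussianMeasure n α) := (memLp_congr_ae hvg).1 (Lp.memLp v)
  refine ⟨mk g hgd hgL, ?_⟩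
  rw [(toL2 n α).isometry.isUniformInducing.isInducing.tendsto_nhds_iff]
  have : toL2 n α (mk g hgd hgL) = v := by
    refine Lp.ext ?_
    exact hgL.coeFn_toLp.trans hvg.symm
  rw [this]
  exact hv

end FockSpace

section CompositionOperator

variable {n : ℕ}

/-- `C_φ : f ↦ f ∘ φ` maps `F²_α(ℂⁿ)` into itself and is bounded there. -/
def IsBoundedComposition (α : ℝ) [Fact (0 < α)]
    (φ : EuclideanSpace ℂ (Fin n) → EuclideanSpace ℂ (Fin n)) : Prop :=
  ∃ C : ℝ, ∀ f : FockSpace n α, ∃ g : FockSpace n α, (∀ z, g z = f (φ z)) ∧ ‖g‖ ≤ C * ‖f‖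

/-- The bounded composition operator `C_φ : f ↦ f ∘ φ` on `F²_α(ℂⁿ)`. -/
def compositionOperator {α : ℝ} [Fact (0 < α)]
    {φ : EuclideanSpace ℂ (Fin n) → EuclideanSpace ℂ (Fin n)} (h : IsBoundedComposition α φ) :
    FockSpace n α →L[ℂ] FockSpace n α :=
  LinearMap.mkContinuousOfExistsBound
    { toFun := fun f ↦ (h.choose_spec f).choose
      map_add' := fun f g ↦ FockSpace.ext fun z ↦ by
        rw [(h.choose_spec (f + g)).choose_spec.1 z, FockSpace.add_apply, FockSpace.add_apply,
          (h.choose_spec f).choose_spec.1 z, (h.choose_spec g).choose_spec.1 z]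
      map_smul' := fun c f ↦ FockSpace.ext fun z ↦ by
        rw [(h.choose_spec (c • f)).choose_spec.1 z, FockSpace.smul_apply, RingHom.id_apply,
          FockSpace.smul_apply, (h.choose_spec f).choose_spec.1 z] }
    ⟨h.choose, fun f ↦ (h.choose_spec f).choose_spec.2⟩

@[simp] theorem compositionOperator_apply {α : ℝ} [Fact (0 < α)]
    {φ : EuclideanSpace ℂ (Fin n) → EuclideanSpace ℂ (Fin n)} (h : IsBoundedComposition α φ)
    (f : FockSpace n α) (z : EuclideanSpace ℂ (Fin n)) :
    compositionOperator h f z = f (φ z) :=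
  (h.choose_spec f).choose_spec.1 z

end CompositionOperator

/-- A bounded operator `T` on a Hilbert space is essentially normal if its self-commutator
`T* T - T T*` is compact. -/
def IsEssentiallyNormal {H : Type*} [NormedAddCommGroup H] [InnerProductSpace ℂ H]
    [CompleteSpace H] (T : H →L[ℂ] H) : Prop :=
  IsCompactOperator (ContinuousLinearMap.adjoint T ∘L T - T ∘L ContinuousLinearMap.adjoint T)

end

noncomputable section

/-! ### Gaussian integrals and the mean value property. -/

namespace FockSpace

variable {n : ℕ} {α : ℝ}

/-! Everything is read off the reproducing kernels `K_w = exp(α⟨w, ·⟩)`, whose span is dense and on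
which `C_φ* K_w = K_{φ(w)}`. Comparing norms of kernels, boundedness of `C_φ` gives `‖φ w‖² ≤ ‖w‖² +
c`; by Cauchy estimates and Liouville, `φ z = A z + b` with `‖A‖ ≤ 1`, and then `C_φ K_w` is a
multiple of `K_{A* w}`. If `‖A‖ < 1` (in particular if `n = 0`), dominated convergence makes `C_φ`
compact.

Suppose `‖A‖ = 1`, attained at a unit vector `ζ`, and let the self-commutator `S` be compact.
Normalized kernels at points going to infinity are weakly null, so `S` sends them to zero in norm.
Along `w = kζ`, the pairing of `S` with the normalized kernel is the exponential of a quadratic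
polynomial in `k` minus the constant `exp(α‖b‖²)`. Its convergence to zero forces `b = 0` and `‖A*
ζ‖ = 1` (`norm_adjoint_apply_of_isEssentiallyNormal`), hence `A*Aζ = AA*ζ = ζ`.

Now `S K_w = K_{AA*w} - K_{A*Aw}`, and both `AA*` and `A*A` fix `ζ` and preserve its orthogonal
complement. Kernels factor over orthogonal sums, so the normalized size of `S K_{sζ+v}`, for `v ⊥
ζ`, does not depend on `s`. Since it tends to zero as `s → ∞`, it vanishes identically: `S = 0`
(`selfCommutator_eq_zero_of_isEssentiallyNormal`) and `C_φ` is normal. -/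

theorem integrable_gaussianMeasure_iff (hα : 0 < α) {F : EuclideanSpace ℂ (Fin n) → ℂ} :
    Integrable F (gaussianMeasure n α) ↔
      Integrable fun z ↦ (((α / Real.pi) ^ n * Real.exp (-α * ‖z‖ ^ 2) : ℝ) : ℂ) * F z := by
  rw [gaussianMeasure, integrable_withDensity_iff_integrable_smul' (by fun_prop) (by simp)]
  simp only [ENNReal.toReal_ofReal (gaussianMeasure_density_pos hα _).le, Complex.real_smul]

theorem integral_gaussianMeasure_complex (hα : 0 < α) (F : EuclideanSpace ℂ (Fin n) → ℂ) :
    ∫ z, F z ∂(gaussianMeasure n α)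
      = ∫ z, (((α / Real.pi) ^ n * Real.exp (-α * ‖z‖ ^ 2) : ℝ) : ℂ) * F z := by
  rw [gaussianMeasure, integral_withDensity_eq_integral_toReal_smul (by fun_prop) (by simp)]
  simp only [ENNReal.toReal_ofReal (gaussianMeasure_density_pos hα _).le, Complex.real_smul]

theorem integrable_exp_neg_mul_sq_norm (n : ℕ) {a : ℝ} (ha : 0 < a) :
    Integrable fun z : EuclideanSpace ℂ (Fin n) ↦ Real.exp (-a * ‖z‖ ^ 2) := by
  have h := (GaussianFourier.integrable_cexp_neg_mul_sq_norm_add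
    (V := EuclideanSpace ℂ (Fin n)) (b := (a : ℂ)) (by simpa using ha) 0 0).norm
  refine h.congr (Filter.Eventually.of_forall fun z ↦ ?_)
  simp [Complex.norm_exp, ← Complex.ofReal_pow]

theorem isProbabilityMeasure_gaussianMeasure (n : ℕ) (hα : 0 < α) :
    IsProbabilityMeasure (gaussianMeasure n α) := by
  constructor
  have h : ∫ z : EuclideanSpace ℂ (Fin n), (α / Real.pi) ^ n * Real.exp (-α * ‖z‖ ^ 2) = 1 := by
    rw [integral_const_mul, GaussianFourier.integral_rexp_neg_mul_sq_norm hα]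
    have hd : (Module.finrank ℝ (EuclideanSpace ℂ (Fin n)) / 2 : ℝ) = n := by
      rw [← Module.finrank_mul_finrank ℝ ℂ]
      simp
    rw [hd, Real.rpow_natCast, ← mul_pow]
    have := Real.pi_pos
    field_simp
    simp
  rw [gaussianMeasure, withDensity_apply _ MeasurableSet.univ, Measure.restrict_univ,
    ← ofReal_integral_eq_lintegral_ofReal ((integrable_exp_neg_mul_sq_norm n hα).const_mul _)
      (Filter.Eventually.of_forall fun z ↦ (gaussianMeasure_density_pos hα z).le), h]
  simp

theorem measurePreserving_smul_gaussianMeasure {c : ℂ} (hc : ‖c‖ = 1) :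
    MeasurePreserving (fun z : EuclideanSpace ℂ (Fin n) ↦ c • z)
      (gaussianMeasure n α) (gaussianMeasure n α) := by
  have hc0 : c ≠ 0 := fun h ↦ by simp [h] at hc
  let L : EuclideanSpace ℂ (Fin n) ≃ₗᵢ[ℝ] EuclideanSpace ℂ (Fin n) :=
    { (LinearEquiv.smulOfNeZero ℂ (EuclideanSpace ℂ (Fin n)) c hc0).restrictScalars ℝ with
      norm_map' := fun w ↦ by
        change ‖c • w‖ = ‖w‖
        simp [norm_smul, hc] }
  have hL : (L : EuclideanSpace ℂ (Fin n) → _) = fun w ↦ c • w := rfl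
  rw [← hL]
  refine ⟨L.continuous.measurable, Measure.ext fun s hs ↦ ?_⟩
  rw [Measure.map_apply L.continuous.measurable hs, gaussianMeasure,
    withDensity_apply _ (L.continuous.measurable hs), withDensity_apply _ hs]
  simpa only [LinearIsometryEquiv.norm_map] using L.measurePreserving.setLIntegral_comp_preimage_emb
    L.toHomeomorph.measurableEmbedding
    (fun z ↦ ENNReal.ofReal ((α / Real.pi) ^ n * Real.exp (-α * ‖z‖ ^ 2))) s

/-- Mean value property of entire functions with respect to the Gaussian measure. -/
theorem integral_gaussianMeasure_eq_apply_zero (hα : 0 < α) {g : EuclideanSpace ℂ (Fin n) → ℂ}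
    (hg : Differentiable ℂ g) (hi : Integrable g (gaussianMeasure n α)) :
    ∫ z, g z ∂(gaussianMeasure n α) = g 0 := by
  have := isProbabilityMeasure_gaussianMeasure n hα
  have hgc := hg.continuous
  have hmp : ∀ θ : ℝ, MeasurePreserving
      (fun z : EuclideanSpace ℂ (Fin n) ↦ Complex.exp (θ * Complex.I) • z)
      (gaussianMeasure n α) (gaussianMeasure n α) := fun θ ↦
    measurePreserving_smul_gaussianMeasure (Complex.norm_exp_ofReal_mul_I θ)
  have hemb : ∀ θ : ℝ, MeasurableEmbedding
      (fun z : EuclideanSpace ℂ (Fin n) ↦ Complex.exp (θ * Complex.I) • z) := fun θ ↦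
    (Homeomorph.smulOfNeZero _ (Complex.exp_ne_zero _)).measurableEmbedding
  -- Rotations preserve the measure, so `g` may be replaced by its average over circles centred at
  -- the origin, which is `g 0` by the one-variable mean value property.
  have rot : ∀ θ : ℝ, ∫ z, g (Complex.exp (θ * Complex.I) • z) ∂(gaussianMeasure n α)
      = ∫ z, g z ∂(gaussianMeasure n α) := fun θ ↦ (hmp θ).integral_comp (hemb θ) g
  have rotn : ∀ θ : ℝ, ∫ z, ‖g (Complex.exp (θ * Complex.I) • z)‖ ∂(gaussianMeasure n α)
      = ∫ z, ‖g z‖ ∂(gaussianMeasure n α) := fun θ ↦ (hmp θ).integral_comp (hemb θ) fun z ↦ ‖g z‖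
  have mv : ∀ w, (∫ θ in (0 : ℝ)..2 * Real.pi, g (Complex.exp (θ * Complex.I) • w))
      = 2 * Real.pi * g 0 := by
    intro w
    have h := DiffContOnCl.circleAverage (f := fun t : ℂ ↦ g (t • w)) (c := 0) (R := 1)
      (by
        have : Differentiable ℂ fun t : ℂ ↦ g (t • w) := hg.comp (by fun_prop)
        exact this.diffContOnCl)
    rw [Real.circleAverage_def] at h
    simp only [circleMap, zero_smul, zero_add, Complex.ofReal_one, one_mul] at h
    rw [← h]
    simp only [Complex.real_smul]
    push_cast
    rw [mul_inv_cancel_left₀ (by simp)]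
  have swap : ∫ θ in (0 : ℝ)..2 * Real.pi,
        ∫ z, g (Complex.exp (θ * Complex.I) • z) ∂(gaussianMeasure n α)
      = ∫ z, (∫ θ in (0 : ℝ)..2 * Real.pi, g (Complex.exp (θ * Complex.I) • z))
        ∂(gaussianMeasure n α) := by
    refine intervalIntegral_integral_swap ?_
    rw [integrable_prod_iff]
    · refine ⟨Filter.Eventually.of_forall fun θ ↦ ?_, ?_⟩
      · exact ((hmp θ).integrable_comp_emb (hemb θ)).2 hi
      · simp only [Function.uncurry_def, rotn]
        rw [Set.uIoc_of_le (by positivity)]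
        exact integrable_const _
    · apply Continuous.aestronglyMeasurable
      simp only [Function.uncurry_def]
      fun_prop
  simp only [rot, mv] at swap
  rw [intervalIntegral.integral_const, integral_const] at swap
  simp only [Complex.real_smul, sub_zero] at swap
  push_cast at swap
  have h2 : (2 * Real.pi : ℂ) ≠ 0 := by simp
  apply mul_left_cancel₀ h2
  simpa using swap

theorem norm_exp_mul_inner (a : ℝ) (w z : EuclideanSpace ℂ (Fin n)) :
    ‖Complex.exp (a * inner ℂ w z)‖ = Real.exp (a * (inner ℂ w z).re) := by
  rw [Complex.norm_exp, Complex.re_ofReal_mul]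

theorem norm_sub_sq_complex (z w : EuclideanSpace ℂ (Fin n)) :
    ‖z - w‖ ^ 2 = ‖z‖ ^ 2 - 2 * (inner ℂ w z).re + ‖w‖ ^ 2 := by
  rw [@norm_sub_sq ℂ, ← inner_conj_symm z w]
  rw [RCLike.re_eq_complex_re, Complex.conj_re]

theorem norm_add_sq_complex (z w : EuclideanSpace ℂ (Fin n)) :
    ‖z + w‖ ^ 2 = ‖z‖ ^ 2 + 2 * (inner ℂ w z).re + ‖w‖ ^ 2 := by
  rw [@norm_add_sq ℂ, ← inner_conj_symm z w]
  rw [RCLike.re_eq_complex_re, Complex.conj_re]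

theorem differentiable_exp_mul_inner (a : ℂ) (w : EuclideanSpace ℂ (Fin n)) :
    Differentiable ℂ fun z ↦ Complex.exp (a * inner ℂ w z) := by
  have : Differentiable ℂ fun z ↦ inner ℂ w z := (innerSL ℂ w).differentiable
  fun_prop

/-! ### Reproducing kernels. -/

variable [hα : Fact (0 < α)]

/-- The reproducing kernel `K_w(z) = exp(α ⟨w, z⟩)`. -/
def kernel (α : ℝ) [hα : Fact (0 < α)] (w : EuclideanSpace ℂ (Fin n)) : FockSpace n α :=
  mk (fun z ↦ Complex.exp (α * inner ℂ w z)) (differentiable_exp_mul_inner _ _) <| by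
    have hd := differentiable_exp_mul_inner (α : ℂ) w
    refine (memLp_two_iff_integrable_sq_norm hd.continuous.aestronglyMeasurable).2 ?_
    rw [gaussianMeasure, integrable_withDensity_iff_integrable_smul' (by fun_prop) (by simp)]
    simp only [ENNReal.toReal_ofReal (gaussianMeasure_density_pos hα.out _).le]
    -- Completing the square: `|K_w(z)|² exp(-α‖z‖²) = exp(α‖w‖²) exp(-α‖z - w‖²)`.
    have h := ((integrable_exp_neg_mul_sq_norm n hα.out).comp_sub_right w).const_mul
      ((α / Real.pi) ^ n * Real.exp (α * ‖w‖ ^ 2))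
    refine h.congr (Filter.Eventually.of_forall fun z ↦ ?_)
    simp only [norm_exp_mul_inner, smul_eq_mul, norm_sub_sq_complex, mul_assoc, ← Real.exp_add,
      ← Real.exp_nat_mul]
    congr 2
    push_cast
    ring

theorem kernel_apply (w z : EuclideanSpace ℂ (Fin n)) :
    kernel α w z = Complex.exp (α * inner ℂ w z) := rfl

/-- After the translation `z ↦ z + w`, the conjugate kernel and the Gaussian weight combine into the
centred weight times the entire factor `exp(-α⟨w, z⟩)`. The mean value property then evaluates the
integral at the origin, where the integrand is `f w`. -/
theorem inner_kernel_left (w : EuclideanSpace ℂ (Fin n)) (f : FockSpace n α) :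
    inner ℂ (kernel α w) f = f w := by
  have key : ∀ z : EuclideanSpace ℂ (Fin n),
      (((α / Real.pi) ^ n * Real.exp (-α * ‖z + w‖ ^ 2) : ℝ) : ℂ) *
        (starRingEnd ℂ (kernel α w (z + w)) * f (z + w))
      = (((α / Real.pi) ^ n * Real.exp (-α * ‖z‖ ^ 2) : ℝ) : ℂ) *
        (Complex.exp ((-α : ℝ) * inner ℂ w z) * f (z + w)) := by
    intro z
    have hre : (2 * (inner ℂ w z).re : ℂ) = inner ℂ w z + inner ℂ z w := by
      rw [← inner_conj_symm z w, Complex.add_conj]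
      push_cast
      ring
    have hww : inner ℂ w w = (‖w‖ : ℂ) ^ 2 := inner_self_eq_norm_sq_to_K (𝕜 := ℂ) w
    rw [kernel_apply, ← Complex.exp_conj, map_mul, inner_conj_symm, Complex.conj_ofReal,
      norm_add_sq_complex, inner_add_left, hww]
    push_cast
    rw [hre, mul_assoc, mul_assoc, ← mul_assoc (Complex.exp _), ← mul_assoc (Complex.exp _),
      ← Complex.exp_add, ← Complex.exp_add]
    congr 3
    ring
  have hd : Differentiable ℂ fun z ↦ Complex.exp ((-α : ℝ) * inner ℂ w z) * f (z + w) :=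
    (differentiable_exp_mul_inner _ w).mul (f.differentiable.comp (by fun_prop))
  have hint := (integrable_gaussianMeasure_iff hα.out).1 (integrable_conj_mul (kernel α w) f)
  have hint' := hint.comp_add_right w
  simp only [key] at hint'
  rw [inner_def, integral_gaussianMeasure_complex hα.out, ← integral_add_right_eq_self _ w]
  simp only [key]
  rw [← integral_gaussianMeasure_complex hα.out, integral_gaussianMeasure_eq_apply_zero hα.out hd
    ((integrable_gaussianMeasure_iff hα.out).2 hint')]
  simp

theorem inner_kernel_kernel (w z : EuclideanSpace ℂ (Fin n)) :
    inner ℂ (kernel α w) (kernel α z) = Complex.exp (α * inner ℂ z w) := by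
  rw [inner_kernel_left, kernel_apply]

theorem norm_kernel_sq (w : EuclideanSpace ℂ (Fin n)) :
    ‖kernel α w‖ ^ 2 = Real.exp (α * ‖w‖ ^ 2) := by
  have h := inner_self_eq_norm_sq_to_K (𝕜 := ℂ) (kernel α w)
  have hww : inner ℂ w w = (‖w‖ : ℂ) ^ 2 := inner_self_eq_norm_sq_to_K (𝕜 := ℂ) w
  rw [inner_kernel_kernel, hww] at h
  simp only [Complex.coe_algebraMap] at h
  exact_mod_cast h.symm

theorem norm_kernel (w : EuclideanSpace ℂ (Fin n)) :
    ‖kernel α w‖ = Real.exp (α * ‖w‖ ^ 2 / 2) := by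
  rw [← sq_eq_sq₀ (norm_nonneg _) (Real.exp_pos _).le, norm_kernel_sq, ← Real.exp_nat_mul]
  congr 1
  push_cast
  ring

theorem norm_apply_le (f : FockSpace n α) (w : EuclideanSpace ℂ (Fin n)) :
    ‖f w‖ ≤ Real.exp (α * ‖w‖ ^ 2 / 2) * ‖f‖ := by
  rw [← inner_kernel_left, ← norm_kernel]
  exact norm_inner_le_norm _ _

/-- By the reproducing property, a function orthogonal to every kernel vanishes at every point. -/
theorem dense_span_range_kernel :
    Dense (Submodule.span ℂ (Set.range (kernel α (n := n))) : Set (FockSpace n α)) := by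
  rw [Submodule.dense_iff_topologicalClosure_eq_top, Submodule.topologicalClosure_eq_top_iff,
    Submodule.eq_bot_iff]
  intro f hf
  ext w
  rw [← inner_kernel_left]
  exact hf _ (Submodule.subset_span ⟨w, rfl⟩)

end FockSpace

/-! ### Weakly null sequences, and entire maps of linear growth. -/

/-- A compact operator maps bounded weakly null sequences to norm null sequences. -/
theorem IsCompactOperator.tendsto_zero_of_weakly_null {H : Type*} [NormedAddCommGroup H]
    [InnerProductSpace ℂ H] [CompleteSpace H] {S : H →L[ℂ] H} (hS : IsCompactOperator S)
    {u : ℕ → H} {r : ℝ} (hu : ∀ k, ‖u k‖ ≤ r)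
    (hw : ∀ f, Filter.Tendsto (fun k ↦ inner ℂ f (u k)) Filter.atTop (nhds 0)) :
    Filter.Tendsto (fun k ↦ S (u k)) Filter.atTop (nhds 0) := by
  obtain ⟨K, hK, hSK⟩ := IsCompactOperator.image_closedBall_subset_compact
    (f := (S : H →ₗ[ℂ] H)) hS r
  refine Filter.tendsto_of_subseq_tendsto fun ns hns ↦ ?_
  obtain ⟨g, -, σ, hσ, hg⟩ := hK.tendsto_subseq (x := fun k ↦ S (u (ns k)))
    fun k ↦ hSK ⟨u (ns k), by simpa using hu (ns k), rfl⟩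
  refine ⟨σ, ?_⟩
  -- Any norm limit `g` of a subsequence of `S u` is also its weak limit, which is zero because `⟨g,
  -- S u⟩ = ⟨S* g, u⟩`.
  have h1 : Filter.Tendsto (fun k ↦ inner ℂ g (S (u (ns (σ k))))) Filter.atTop
      (nhds (inner ℂ g g)) := tendsto_const_nhds.inner hg
  have h2 : Filter.Tendsto (fun k ↦ inner ℂ g (S (u (ns (σ k))))) Filter.atTop (nhds 0) := by
    simp only [← ContinuousLinearMap.adjoint_inner_left]
    exact (hw _).comp (hns.comp hσ.tendsto_atTop)
  have h3 : g = 0 := inner_self_eq_zero.1 (tendsto_nhds_unique h1 h2)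
  rw [h3] at hg
  exact hg

/-- Weak convergence to zero of a bounded sequence may be tested on a set with dense span. -/
theorem tendsto_inner_zero_of_dense_span {H : Type*} [NormedAddCommGroup H]
    [InnerProductSpace ℂ H] {s : Set H} (hs : Dense (Submodule.span ℂ s : Set H))
    {u : ℕ → H} {r : ℝ} (hu : ∀ k, ‖u k‖ ≤ r)
    (hw : ∀ f ∈ s, Filter.Tendsto (fun k ↦ inner ℂ f (u k)) Filter.atTop (nhds 0)) (f : H) :
    Filter.Tendsto (fun k ↦ inner ℂ f (u k)) Filter.atTop (nhds 0) := by
  have hr : 0 ≤ r := (norm_nonneg _).trans (hu 0)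
  have hspan : ∀ f ∈ Submodule.span ℂ s,
      Filter.Tendsto (fun k ↦ inner ℂ f (u k)) Filter.atTop (nhds 0) := by
    intro f hf
    induction hf using Submodule.span_induction with
    | mem f hf => exact hw f hf
    | zero => simp
    | add f g _ _ hf hg => simpa [inner_add_left] using hf.add hg
    | smul c f _ hf => simpa [inner_smul_left, mul_comm] using hf.const_mul (starRingEnd ℂ c)
  rw [Metric.tendsto_atTop]
  intro ε hε
  -- Using `r + 1` instead of `r` keeps the denominator positive when `r = 0`.
  obtain ⟨g, hg, hfg⟩ := Metric.dense_iff.1 hs f (ε / (2 * (r + 1))) (by positivity)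
  obtain ⟨N, hN⟩ := Metric.tendsto_atTop.1 (hspan g hfg) (ε / 2) (by positivity)
  refine ⟨N, fun k hk ↦ ?_⟩
  have h1 := hN k hk
  rw [dist_zero_right] at h1 ⊢
  have h2 : inner ℂ f (u k) = inner ℂ (f - g) (u k) + inner ℂ g (u k) := by
    rw [inner_sub_left]
    ring
  have h3 : ‖f - g‖ < ε / (2 * (r + 1)) := by
    rw [← dist_eq_norm, dist_comm]
    exact hg
  rw [lt_div_iff₀ (by positivity)] at h3
  have h4 := norm_inner_le_norm (𝕜 := ℂ) (f - g) (u k)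
  have h5 := mul_le_mul_of_nonneg_left (hu k) (norm_nonneg (f - g))
  rw [h2]
  have h6 := norm_add_le (inner ℂ (f - g) (u k)) (inner ℂ g (u k))
  have h7 := norm_nonneg (f - g)
  linarith

/-- An entire map of linear growth is affine. -/
theorem eq_affine_of_differentiable_of_norm_le {E F : Type*} [NormedAddCommGroup E] [NormedSpace ℂ E]
    [NormedAddCommGroup F] [NormedSpace ℂ F] [CompleteSpace F] {φ : E → F}
    (hφ : Differentiable ℂ φ) {c : ℝ} (h : ∀ z, ‖φ z‖ ≤ ‖z‖ + c) (z : E) :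
    φ z = fderiv ℂ φ 0 z + φ 0 := by
  set g : ℂ → F := fun t ↦ φ (t • z) with hg
  have hgd : Differentiable ℂ g := hφ.comp (by fun_prop)
  have hc : 0 ≤ c := by simpa using (norm_nonneg _).trans (h 0)
  have hbound : ∀ t, ‖deriv g t‖ ≤ ‖z‖ + 1 := by
    intro t
    -- The radius grows with `t` so that `g` is at most `(‖z‖ + 1) * R` on the circle; the Cauchy
    -- estimate for `deriv g t` is then independent of `t`, and Liouville applies to `deriv g`.
    set R : ℝ := ‖t‖ * ‖z‖ + c + 1 with hR
    have hRpos : 0 < R := by positivity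
    have h1 := Complex.norm_deriv_le_of_forall_mem_sphere_norm_le (f := g) (c := t)
      (C := (‖z‖ + 1) * R) hRpos hgd.diffContOnCl fun s hs ↦ ?_
    · rwa [mul_div_cancel_right₀ _ hRpos.ne'] at h1
    · have h2 : ‖s‖ ≤ ‖t‖ + R := by
        have h3 : ‖s - t‖ = R := by simpa [dist_eq_norm] using hs
        have h4 := norm_add_le t (s - t)
        rw [add_sub_cancel] at h4
        linarith
      have h5 := h (s • z)
      rw [norm_smul] at h5
      have h6 := mul_le_mul_of_nonneg_right h2 (norm_nonneg z)
      simp only [hg]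
      nlinarith
  have hconst : ∀ t, deriv g t = deriv g 0 := fun t ↦ by
    refine hgd.deriv.apply_eq_apply_of_bounded ?_ t 0
    refine isBounded_iff_forall_norm_le.2 ⟨‖z‖ + 1, ?_⟩
    rintro _ ⟨t, rfl⟩
    exact hbound t
  have hd0 : deriv g 0 = fderiv ℂ φ 0 z := by
    have hd : HasDerivAt (fun t : ℂ ↦ t • z) z 0 := by
      simpa using (hasDerivAt_id (0 : ℂ)).smul_const z
    have h0 : HasFDerivAt φ (fderiv ℂ φ 0) ((0 : ℂ) • z) := by
      simpa using (hφ 0).hasFDerivAt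
    exact (h0.comp_hasDerivAt 0 hd).deriv
  have hk : Differentiable ℂ fun t : ℂ ↦ g t - t • deriv g 0 := hgd.sub (by fun_prop)
  have := is_const_of_deriv_eq_zero hk (fun t ↦ by
    have h1 := (hgd t).hasDerivAt.sub ((hasDerivAt_id t).smul_const (deriv g 0))
    exact h1.deriv.trans (by rw [hconst t, one_smul, sub_self])) 1 0
  simp only [hg, one_smul, zero_smul, sub_zero] at this
  rw [← hd0, ← this, add_sub_cancel]

/-! ### A growth criterion for compactness. -/

namespace FockSpace

variable {n : ℕ} {α : ℝ} [hα : Fact (0 < α)]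

/-- Separability is what makes Banach–Alaoglu available for sequences; it is inherited from `L²`. -/
instance : SecondCountableTopology (FockSpace n α) := by
  have := isProbabilityMeasure_gaussianMeasure n hα.out
  have : Fact ((2 : ENNReal) ≠ ⊤) := ⟨by norm_num⟩
  have : SecondCountableTopology (Lp ℂ 2 (gaussianMeasure n α)) := Lp.SecondCountableTopology
  exact (toL2 n α).isometry.isEmbedding.secondCountableTopology

/-- Norm bounded sequences in the Fock space have pointwise convergent subsequences. -/
theorem exists_subseq_tendsto_apply {u : ℕ → FockSpace n α} {r : ℝ} (hu : ∀ k, ‖u k‖ ≤ r) :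
    ∃ (f : FockSpace n α) (σ : ℕ → ℕ), ‖f‖ ≤ r ∧ StrictMono σ ∧
      ∀ w, Filter.Tendsto (fun k ↦ u (σ k) w) Filter.atTop (nhds (f w)) := by
  obtain ⟨x, hxr, σ, hσ, hx⟩ := WeakDual.isSeqCompact_closedBall ℂ (FockSpace n α) 0 r
    (x := fun k ↦ WeakDual.toStrongDual.symm (InnerProductSpace.toDual ℂ _ (u k)))
    (fun k ↦ by simpa using hu k)
  refine ⟨(InnerProductSpace.toDual ℂ _).symm (WeakDual.toStrongDual x), σ,
    by simpa using hxr, hσ, fun w ↦ ?_⟩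
  have h1 := ((WeakDual.eval_continuous (𝕜 := ℂ) (kernel α w)).tendsto x).comp hx
  have h2 := (Complex.continuous_conj.tendsto _).comp h1
  rw [← inner_kernel_left, ← inner_conj_symm, InnerProductSpace.toDual_symm_apply]
  refine h2.congr fun k ↦ ?_
  rw [← inner_kernel_left, ← inner_conj_symm]
  rfl

/-- Composition with a map of strictly sublinear quadratic growth is compact. -/
theorem isCompactOperator_compositionOperator_of_sq_norm_le
    {φ : EuclideanSpace ℂ (Fin n) → EuclideanSpace ℂ (Fin n)}
    (hb : IsBoundedComposition α φ) {s c : ℝ} (hs : s < 1)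
    (h : ∀ z, ‖φ z‖ ^ 2 ≤ s * ‖z‖ ^ 2 + c) :
    IsCompactOperator (compositionOperator hb) := by
  have hcomp : IsSeqCompact
      (compositionOperator hb '' Metric.closedBall (0 : FockSpace n α) 1) := by
    intro v hv
    choose u hu huv using hv
    obtain rfl : (fun k ↦ compositionOperator hb (u k)) = v := funext huv
    have hu1 : ∀ k, ‖u k‖ ≤ 1 := fun k ↦ by simpa using hu k
    obtain ⟨f, σ, hf1, hσ, hf⟩ := exists_subseq_tendsto_apply hu1
    have hlim : Filter.Tendsto (fun k ↦ compositionOperator hb (u (σ k))) Filter.atTop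
        (nhds (compositionOperator hb f)) := by
      rw [tendsto_iff_norm_sub_tendsto_zero]
      have hsq : Filter.Tendsto (fun k ↦ ‖compositionOperator hb (u (σ k))
          - compositionOperator hb f‖ ^ 2) Filter.atTop (nhds 0) := by
        simp only [norm_sq_eq]
        have hz : (∫ _, (0 : ℝ) ∂(gaussianMeasure n α)) = 0 := by simp
        rw [← hz]
        -- The reproducing bound `|f(φ z)| ≤ exp(α‖φ z‖²/2) ‖f‖` and the growth hypothesis supply
        -- the majorant; `s < 1` makes it integrable against the Gaussian.
        refine tendsto_integral_of_dominated_convergence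
          (fun z ↦ (1 + ‖f‖) ^ 2 * Real.exp (α * c) * Real.exp (α * s * ‖z‖ ^ 2))
          (fun k ↦ ?_) ?_ (fun k ↦ ?_) ?_
        · have := (compositionOperator hb (u (σ k))
            - compositionOperator hb f).differentiable.continuous
          exact (this.norm.pow 2).aestronglyMeasurable
        · refine Integrable.const_mul ?_ _
          rw [gaussianMeasure, integrable_withDensity_iff_integrable_smul' (by fun_prop) (by simp)]
          simp only [ENNReal.toReal_ofReal (gaussianMeasure_density_pos hα.out _).le]
          have hi := (integrable_exp_neg_mul_sq_norm n
            (mul_pos hα.out (sub_pos.2 hs))).const_mul ((α / Real.pi) ^ n)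
          refine hi.congr (Filter.Eventually.of_forall fun z ↦ ?_)
          simp only [smul_eq_mul, mul_assoc, ← Real.exp_add]
          congr 2
          ring
        · refine Filter.Eventually.of_forall fun z ↦ ?_
          rw [Real.norm_of_nonneg (by positivity), sub_apply, compositionOperator_apply,
            compositionOperator_apply, ← sub_apply]
          have h1 := norm_apply_le (u (σ k) - f) (φ z)
          have h2 : ‖u (σ k) - f‖ ≤ 1 + ‖f‖ :=
            (norm_sub_le _ _).trans (by gcongr; exact hu1 _)
          calc ‖(u (σ k) - f) (φ z)‖ ^ 2
              ≤ (Real.exp (α * ‖φ z‖ ^ 2 / 2) * (1 + ‖f‖)) ^ 2 := by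
                gcongr
                exact h1.trans (by gcongr)
            _ = (1 + ‖f‖) ^ 2 * Real.exp (α * ‖φ z‖ ^ 2) := by
                rw [mul_pow, ← Real.exp_nat_mul, mul_comm]
                congr 2
                push_cast
                ring
            _ ≤ (1 + ‖f‖) ^ 2 * Real.exp (α * (s * ‖z‖ ^ 2 + c)) := by
                have := hα.out
                gcongr
                exact h z
            _ = _ := by
                rw [mul_assoc, ← Real.exp_add]
                congr 2
                ring
        · refine Filter.Eventually.of_forall fun z ↦ ?_
          simp only [sub_apply, compositionOperator_apply]
          simpa using (((hf (φ z)).sub_const (f (φ z))).norm.pow 2)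
      simpa using hsq.sqrt
    refine ⟨compositionOperator hb f, ⟨f, by simpa using hf1, rfl⟩, σ, hσ, hlim⟩
  exact (isCompactOperator_iff_image_closedBall_subset_compact
    (compositionOperator hb : FockSpace n α →ₗ[ℂ] FockSpace n α) one_pos).2
    ⟨_, hcomp.isCompact, subset_rfl⟩

end FockSpace

/-! ### Elementary facts on polynomials and contractions. -/

theorem nonpos_of_forall_quadratic_nonpos {p q r : ℝ} (h : ∀ t : ℝ, p * t ^ 2 + q * t + r ≤ 0) :
    p ≤ 0 := by
  by_contra! hp
  -- Chosen so that `t ≥ 1` and `p * t` exceeds `|q| + |r|`, whence the leading term dominates.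
  set t := (|q| + |r| + 1) / p + 1 with ht
  have h1 : 1 ≤ t := by
    have : 0 ≤ (|q| + |r| + 1) / p := by positivity
    linarith
  have h2 : p * t = |q| + |r| + 1 + p := by
    rw [ht]
    field_simp
  have h3 := h t
  have h4 : p * t ^ 2 = t * (|q| + |r| + 1 + p) := by
    rw [← h2]
    ring
  nlinarith [neg_abs_le q, neg_abs_le r, abs_nonneg r, abs_nonneg q]

theorem eq_zero_of_forall_linear_nonpos {q r : ℝ} (h : ∀ t : ℝ, q * t + r ≤ 0) : q = 0 := by
  by_contra hq
  have h1 := h ((1 - r) / q)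
  rw [mul_div_cancel₀ _ hq] at h1
  linarith

/-- A quadratic polynomial without constant term which converges along `ℕ` is zero. -/
theorem eq_zero_of_tendsto_quadratic {p q l : ℝ}
    (h : Filter.Tendsto (fun k : ℕ ↦ p * (k : ℝ) ^ 2 + q * k) Filter.atTop (nhds l)) :
    p = 0 ∧ q = 0 ∧ l = 0 := by
  have hinv : Filter.Tendsto (fun k : ℕ ↦ (k : ℝ)⁻¹) Filter.atTop (nhds 0) :=
    tendsto_inv_atTop_nhds_zero_nat
  have hp : p = 0 := by
    have h1 := (h.mul (hinv.pow 2)).sub (hinv.const_mul q)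
    refine tendsto_nhds_unique (tendsto_const_nhds.congr' ?_) (by simpa using h1)
    filter_upwards [Filter.eventually_gt_atTop 0] with k hk
    have : (k : ℝ) ≠ 0 := by positivity
    field_simp
    ring
  subst hp
  have hq : q = 0 := by
    have h1 := h.mul hinv
    refine tendsto_nhds_unique (tendsto_const_nhds.congr' ?_) (by simpa using h1)
    filter_upwards [Filter.eventually_gt_atTop 0] with k hk
    have : (k : ℝ) ≠ 0 := by positivity
    field_simp
  subst hq
  exact ⟨rfl, rfl, tendsto_nhds_unique h (by simp)⟩

/-- A contraction satisfies `T* T x = x` at the vectors whose norm it preserves. -/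
theorem adjoint_apply_self_of_norm_eq {H : Type*} [NormedAddCommGroup H] [InnerProductSpace ℂ H]
    [CompleteSpace H] {T : H →L[ℂ] H} (hT : ‖T‖ ≤ 1) {x : H} (hx : ‖T x‖ = ‖x‖) :
    ContinuousLinearMap.adjoint T (T x) = x := by
  have h1 : ‖ContinuousLinearMap.adjoint T (T x)‖ ≤ ‖x‖ := by
    have := (ContinuousLinearMap.adjoint T).le_opNorm (T x)
    rw [LinearIsometryEquiv.norm_map, hx] at this
    nlinarith [norm_nonneg x]
  -- Expanding, the cross term is `-2‖T x‖² = -2‖x‖²`, while each square is at most `‖x‖²`.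
  have h2 : ‖ContinuousLinearMap.adjoint T (T x) - x‖ ^ 2 ≤ 0 := by
    rw [@norm_sub_sq ℂ, ContinuousLinearMap.adjoint_inner_left, inner_self_eq_norm_sq, hx]
    nlinarith [norm_nonneg x, norm_nonneg (ContinuousLinearMap.adjoint T (T x))]
  have h3 := pow_eq_zero_iff two_ne_zero |>.1 (le_antisymm h2 (sq_nonneg _))
  exact sub_eq_zero.1 (norm_eq_zero.1 h3)

/-! ### Compact operators on normalized kernels. -/

namespace FockSpace

variable {n : ℕ} {α : ℝ} [hα : Fact (0 < α)]

/-- A compact operator maps the normalized reproducing kernels to zero at infinity. -/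
theorem tendsto_normalized_kernel {S : FockSpace n α →L[ℂ] FockSpace n α}
    (hS : IsCompactOperator S) {w : ℕ → EuclideanSpace ℂ (Fin n)}
    (hw : Filter.Tendsto (fun k ↦ ‖w k‖) Filter.atTop Filter.atTop) :
    Filter.Tendsto (fun k ↦ Real.exp (-(α * ‖w k‖ ^ 2)) * ‖S (kernel α (w k))‖ ^ 2)
      Filter.atTop (nhds 0) := by
  have hα' := hα.out
  set u : ℕ → FockSpace n α := fun k ↦
    ((Real.exp (-(α * ‖w k‖ ^ 2 / 2)) : ℝ) : ℂ) • kernel α (w k) with hu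
  have hu1 : ∀ k, ‖u k‖ ≤ 1 := fun k ↦ by
    rw [hu, norm_smul, norm_kernel, Complex.norm_real, Real.norm_of_nonneg (Real.exp_pos _).le,
      ← Real.exp_add]
    simp
  have hlim := hS.tendsto_zero_of_weakly_null hu1
    (tendsto_inner_zero_of_dense_span dense_span_range_kernel hu1 (by
      rintro _ ⟨v, rfl⟩
      -- With `x = ‖w k‖`, this is the exponent bounding the pairing of `K_v` with the normalized
      -- kernel at `w k`; the Gaussian normalization beats the linear term.
      have hbot : Filter.Tendsto (fun x : ℝ ↦ x * (α * ‖v‖ + -(α / 2) * x)) Filter.atTop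
          Filter.atBot :=
        Filter.tendsto_id.atTop_mul_atBot₀ (Filter.tendsto_atBot_add_const_left _ _
          (Filter.tendsto_id.const_mul_atTop_of_neg (by linarith)))
      refine squeeze_zero_norm (fun k ↦ ?_) (Real.tendsto_exp_atBot.comp (hbot.comp hw))
      rw [inner_smul_right, inner_kernel_kernel, norm_mul, norm_exp_mul_inner, Complex.norm_real,
        Real.norm_of_nonneg (Real.exp_pos _).le, ← Real.exp_add, Function.comp_apply,
        Function.comp_apply, Real.exp_le_exp]
      have h1 : (inner ℂ (w k) v).re ≤ ‖w k‖ * ‖v‖ :=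
        (Complex.re_le_norm _).trans (norm_inner_le_norm _ _)
      nlinarith))
  have hsq := hlim.norm.pow 2
  simp only [norm_zero, ne_eq, OfNat.ofNat_ne_zero, not_false_eq_true, zero_pow] at hsq
  refine hsq.congr fun k ↦ ?_
  rw [hu, map_smul, norm_smul, mul_pow, Complex.norm_real,
    Real.norm_of_nonneg (Real.exp_pos _).le, ← Real.exp_nat_mul]
  congr 2
  push_cast
  ring

/-- Cauchy–Schwarz: since `‖K_w‖² = exp(α‖w‖²)`, the normalized pairing is at most the square root
of the quantity in `tendsto_normalized_kernel`. -/
theorem tendsto_inner_normalized_kernel {S : FockSpace n α →L[ℂ] FockSpace n α}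
    (hS : IsCompactOperator S) {w : ℕ → EuclideanSpace ℂ (Fin n)}
    (hw : Filter.Tendsto (fun k ↦ ‖w k‖) Filter.atTop Filter.atTop) :
    Filter.Tendsto (fun k ↦ Real.exp (-(α * ‖w k‖ ^ 2)) *
      (inner ℂ (kernel α (w k)) (S (kernel α (w k)))).re) Filter.atTop (nhds 0) := by
  have h := (tendsto_normalized_kernel hS hw).sqrt
  rw [Real.sqrt_zero] at h
  refine squeeze_zero_norm (fun k ↦ ?_) h
  have h1 : |(inner ℂ (kernel α (w k)) (S (kernel α (w k)))).re|
      ≤ ‖kernel α (w k)‖ * ‖S (kernel α (w k))‖ :=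
    (Complex.abs_re_le_norm _).trans (norm_inner_le_norm _ _)
  rw [norm_mul, Real.norm_of_nonneg (Real.exp_pos _).le, Real.norm_eq_abs]
  refine Real.le_sqrt_of_sq_le ?_
  calc (Real.exp (-(α * ‖w k‖ ^ 2)) * |(inner ℂ (kernel α (w k)) (S (kernel α (w k)))).re|) ^ 2
      ≤ (Real.exp (-(α * ‖w k‖ ^ 2)) * (‖kernel α (w k)‖ * ‖S (kernel α (w k))‖)) ^ 2 := by
        gcongr
    _ = Real.exp (-(α * ‖w k‖ ^ 2)) * ‖S (kernel α (w k))‖ ^ 2 := by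
        rw [mul_pow, mul_pow, norm_kernel_sq, ← Real.exp_nat_mul, ← mul_assoc, ← Real.exp_add]
        congr 2
        push_cast
        ring

/-! ### Composition operators with affine symbol and their self-commutators. -/

section Composition

variable {φ : EuclideanSpace ℂ (Fin n) → EuclideanSpace ℂ (Fin n)}

theorem adjoint_compositionOperator_kernel (hb : IsBoundedComposition α φ)
    (w : EuclideanSpace ℂ (Fin n)) :
    ContinuousLinearMap.adjoint (compositionOperator hb) (kernel α w) = kernel α (φ w) := by
  ext z
  rw [← inner_kernel_left, ContinuousLinearMap.adjoint_inner_right, ← inner_conj_symm,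
    inner_kernel_left, compositionOperator_apply, ← inner_kernel_left, inner_conj_symm,
    inner_kernel_left]

/-- Boundedness of the adjoint on kernels compares `exp(α‖φ w‖²/2)` with `exp(α‖w‖²/2)`; taking
logarithms gives the estimate. -/
theorem exists_sq_norm_le (hb : IsBoundedComposition α φ) :
    ∃ c : ℝ, 0 ≤ c ∧ ∀ w, ‖φ w‖ ^ 2 ≤ ‖w‖ ^ 2 + c := by
  have hα' := hα.out
  set M := ‖ContinuousLinearMap.adjoint (compositionOperator hb)‖ with hM
  have hM0 : 0 ≤ M := norm_nonneg _
  refine ⟨2 * M / α, by positivity, fun w ↦ ?_⟩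
  have h1 := (ContinuousLinearMap.adjoint (compositionOperator hb)).le_opNorm (kernel α w)
  rw [adjoint_compositionOperator_kernel, norm_kernel, norm_kernel, ← hM] at h1
  -- A crude bound that places the operator norm in the exponent, so that exponents can be compared
  -- directly.
  have h2 : M ≤ Real.exp M := by linarith [Real.add_one_le_exp M]
  have h3 := h1.trans (mul_le_mul_of_nonneg_right h2 (Real.exp_pos _).le)
  rw [← Real.exp_add, Real.exp_le_exp] at h3
  have h4 : α * (2 * M / α) = 2 * M := by field_simp
  refine le_of_mul_le_mul_left ?_ hα'
  rw [mul_add, h4]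
  linarith

/-- The symbols of bounded composition operators are affine contractions. -/
theorem exists_affine (hφ : Differentiable ℂ φ) (hb : IsBoundedComposition α φ) :
    ∃ (A : EuclideanSpace ℂ (Fin n) →L[ℂ] EuclideanSpace ℂ (Fin n))
      (b : EuclideanSpace ℂ (Fin n)), (∀ z, φ z = A z + b) ∧ ‖A‖ ≤ 1 ∧
      ∀ z, ‖A z‖ = ‖z‖ → (inner ℂ b (A z)).re = 0 := by
  obtain ⟨c, hc, h⟩ := exists_sq_norm_le hb
  have haff := eq_affine_of_differentiable_of_norm_le hφ (c := Real.sqrt c) fun z ↦ by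
    refine abs_le_of_sq_le_sq' ?_ (by positivity) |>.2
    have h1 := Real.sq_sqrt hc
    have h2 : 0 ≤ ‖z‖ * Real.sqrt c := by positivity
    nlinarith [h z]
  set A := fderiv ℂ φ 0
  set b := φ 0
  -- The growth bound along the real line through `z`: the sign of the leading coefficient gives `‖A
  -- z‖ ≤ ‖z‖`, and when that coefficient is zero the linear one must vanish too.
  have hquad : ∀ z (t : ℝ), (‖A z‖ ^ 2 - ‖z‖ ^ 2) * t ^ 2 + 2 * (inner ℂ b (A z)).re * t
      + (‖b‖ ^ 2 - c) ≤ 0 := by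
    intro z t
    have h1 := h ((t : ℂ) • z)
    rw [haff, map_smul, norm_add_sq_complex, inner_smul_right, norm_smul, norm_smul,
      Complex.re_ofReal_mul, Complex.norm_real, mul_pow, mul_pow, Real.norm_eq_abs, sq_abs] at h1
    linarith
  refine ⟨A, b, haff, ContinuousLinearMap.opNorm_le_bound _ zero_le_one fun z ↦ ?_,
    fun z hz ↦ ?_⟩
  · rw [one_mul]
    refine abs_le_of_sq_le_sq' ?_ (norm_nonneg _) |>.2
    linarith [nonpos_of_forall_quadratic_nonpos (hquad z)]
  · have h1 := eq_zero_of_forall_linear_nonpos (q := 2 * (inner ℂ b (A z)).re)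
      (r := ‖b‖ ^ 2 - c) fun t ↦ by
        have := hquad z t
        rw [hz, sub_self, zero_mul, zero_add] at this
        exact this
    linarith

theorem isCompactOperator_compositionOperator_of_lt_one (hb : IsBoundedComposition α φ)
    {A : EuclideanSpace ℂ (Fin n) →L[ℂ] EuclideanSpace ℂ (Fin n)}
    {b : EuclideanSpace ℂ (Fin n)} (hA : ∀ z, φ z = A z + b) (h : ‖A‖ < 1) :
    IsCompactOperator (compositionOperator hb) := by
  set r := ‖A‖ with hr
  have hr0 : 0 ≤ r := norm_nonneg _
  -- Half of the gap `1 - r²`: as `r² = 1 - 2δ`, the cross term can absorb `δ‖z‖²` and still leave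
  -- the coefficient `1 - δ < 1`.
  set δ := (1 - r ^ 2) / 2 with hδ
  have hδ0 : 0 < δ := by
    rw [hδ]
    nlinarith
  refine isCompactOperator_compositionOperator_of_sq_norm_le hb (s := 1 - δ)
    (c := ‖b‖ ^ 2 + (r * ‖b‖) ^ 2 / δ) (by linarith) fun z ↦ ?_
  have h1 : ‖φ z‖ ≤ r * ‖z‖ + ‖b‖ := by
    rw [hA]
    exact (norm_add_le _ _).trans (by gcongr; exact A.le_opNorm z)
  have h2 : 2 * (r * ‖z‖ * ‖b‖) ≤ δ * ‖z‖ ^ 2 + (r * ‖b‖) ^ 2 / δ := by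
    have h3 : (δ * ‖z‖ - r * ‖b‖) ^ 2 / δ
        = δ * ‖z‖ ^ 2 + (r * ‖b‖) ^ 2 / δ - 2 * (r * ‖z‖ * ‖b‖) := by
      field_simp
      ring
    have h4 : 0 ≤ (δ * ‖z‖ - r * ‖b‖) ^ 2 / δ := by positivity
    linarith
  calc ‖φ z‖ ^ 2 ≤ (r * ‖z‖ + ‖b‖) ^ 2 := by gcongr
    _ = r ^ 2 * ‖z‖ ^ 2 + 2 * (r * ‖z‖ * ‖b‖) + ‖b‖ ^ 2 := by ring
    _ ≤ r ^ 2 * ‖z‖ ^ 2 + (δ * ‖z‖ ^ 2 + (r * ‖b‖) ^ 2 / δ) + ‖b‖ ^ 2 := by gcongr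
    _ = _ := by
      rw [show r ^ 2 = 1 - 2 * δ by rw [hδ]; ring]
      ring

theorem compositionOperator_kernel (hb : IsBoundedComposition α φ)
    {A : EuclideanSpace ℂ (Fin n) →L[ℂ] EuclideanSpace ℂ (Fin n)}
    {b : EuclideanSpace ℂ (Fin n)} (hA : ∀ z, φ z = A z + b) (w : EuclideanSpace ℂ (Fin n)) :
    compositionOperator hb (kernel α w)
      = Complex.exp (α * inner ℂ w b) • kernel α (ContinuousLinearMap.adjoint A w) := by
  ext z
  rw [compositionOperator_apply, smul_apply, kernel_apply, kernel_apply, hA, ← Complex.exp_add,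
    ContinuousLinearMap.adjoint_inner_left, inner_add_right]
  ring_nf

/-- The pairing is `‖C_φ K_w‖² - ‖C_φ* K_w‖²`, and both images are multiples of kernels, whose norms
are explicit. -/
theorem inner_selfCommutator_kernel (hb : IsBoundedComposition α φ)
    {A : EuclideanSpace ℂ (Fin n) →L[ℂ] EuclideanSpace ℂ (Fin n)}
    {b : EuclideanSpace ℂ (Fin n)} (hA : ∀ z, φ z = A z + b) (w : EuclideanSpace ℂ (Fin n)) :
    (inner ℂ (kernel α w) ((ContinuousLinearMap.adjoint (compositionOperator hb) ∘L
      compositionOperator hb - compositionOperator hb ∘L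
      ContinuousLinearMap.adjoint (compositionOperator hb)) (kernel α w))).re
      = Real.exp (α * (2 * (inner ℂ w b).re + ‖ContinuousLinearMap.adjoint A w‖ ^ 2))
        - Real.exp (α * ‖A w + b‖ ^ 2) := by
  have hre : ∀ f : FockSpace n α, (inner ℂ f f).re = ‖f‖ ^ 2 := fun f ↦
    inner_self_eq_norm_sq (𝕜 := ℂ) f
  rw [_root_.sub_apply, ContinuousLinearMap.comp_apply,
    ContinuousLinearMap.comp_apply, inner_sub_right, ContinuousLinearMap.adjoint_inner_right,
    ← ContinuousLinearMap.adjoint_inner_left _ (ContinuousLinearMap.adjoint _ _),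
    Complex.sub_re, hre, hre, adjoint_compositionOperator_kernel,
    compositionOperator_kernel hb hA, norm_smul, norm_exp_mul_inner, hA, mul_pow, norm_kernel_sq,
    norm_kernel_sq, ← Real.exp_nat_mul, ← Real.exp_add]
  congr 2
  push_cast
  ring

/-- If the self-commutator is compact and the linear part preserves the norm of a unit vector,
then so does its adjoint, and the symbol is linear. -/
theorem norm_adjoint_apply_of_isEssentiallyNormal (hb : IsBoundedComposition α φ)
    {A : EuclideanSpace ℂ (Fin n) →L[ℂ] EuclideanSpace ℂ (Fin n)}
    {b : EuclideanSpace ℂ (Fin n)} (hA : ∀ z, φ z = A z + b)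
    (hS : IsEssentiallyNormal (compositionOperator hb)) {ζ : EuclideanSpace ℂ (Fin n)}
    (hζ : ‖ζ‖ = 1) (hAζ : ‖A ζ‖ = 1) (hbζ : (inner ℂ b (A ζ)).re = 0) :
    ‖ContinuousLinearMap.adjoint A ζ‖ = 1 ∧ b = 0 := by
  have hα' := hα.out
  have hw : Filter.Tendsto (fun k : ℕ ↦ ‖((k : ℝ) : ℂ) • ζ‖) Filter.atTop Filter.atTop := by
    simpa [norm_smul, hζ] using tendsto_natCast_atTop_atTop
  have h := tendsto_inner_normalized_kernel hS hw
  simp only [inner_selfCommutator_kernel hb hA] at h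
  -- At `w = kζ` the cross term of `‖A w + b‖²` vanishes by `hbζ` and its leading term is `k²`, so
  -- after normalization the second exponential is the constant `exp(α‖b‖²)`. This limit is
  -- positive, so logarithms may be taken.
  have h1 : Filter.Tendsto (fun k : ℕ ↦ Real.exp (α *
      ((‖ContinuousLinearMap.adjoint A ζ‖ ^ 2 - 1) * (k : ℝ) ^ 2 + 2 * (inner ℂ ζ b).re * k)))
      Filter.atTop (nhds (Real.exp (α * ‖b‖ ^ 2))) := by
    have h2 := h.add_const (Real.exp (α * ‖b‖ ^ 2))
    rw [zero_add] at h2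
    refine h2.congr fun k ↦ ?_
    rw [map_smul, map_smul, norm_add_sq_complex, inner_smul_left, inner_smul_right,
      Complex.conj_ofReal, Complex.re_ofReal_mul, Complex.re_ofReal_mul, norm_smul, norm_smul,
      norm_smul, Complex.norm_real, mul_pow, mul_pow, mul_pow, Real.norm_eq_abs, sq_abs, hζ, hAζ,
      hbζ, mul_sub, ← Real.exp_add, ← Real.exp_add]
    ring_nf
  have h2 := (h1.log (Real.exp_pos _).ne').div_const α
  simp only [Real.log_exp, mul_div_cancel_left₀ _ hα'.ne'] at h2
  obtain ⟨hp, -, hb0⟩ := eq_zero_of_tendsto_quadratic h2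
  refine ⟨?_, by simpa using hb0⟩
  rw [← sq_eq_sq₀ (norm_nonneg _) zero_le_one]
  linarith

theorem selfCommutator_kernel (hb : IsBoundedComposition α φ)
    {A : EuclideanSpace ℂ (Fin n) →L[ℂ] EuclideanSpace ℂ (Fin n)}
    (hA : ∀ z, φ z = A z) (w : EuclideanSpace ℂ (Fin n)) :
    (ContinuousLinearMap.adjoint (compositionOperator hb) ∘L
      compositionOperator hb - compositionOperator hb ∘L
      ContinuousLinearMap.adjoint (compositionOperator hb)) (kernel α w)
      = kernel α (A (ContinuousLinearMap.adjoint A w))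
        - kernel α (ContinuousLinearMap.adjoint A (A w)) := by
  have hC : ∀ w, compositionOperator hb (kernel α w)
      = kernel α (ContinuousLinearMap.adjoint A w) := fun w ↦ by
    rw [compositionOperator_kernel hb (b := 0) (by simpa using hA)]
    simp
  rw [_root_.sub_apply, ContinuousLinearMap.comp_apply,
    ContinuousLinearMap.comp_apply, hC, adjoint_compositionOperator_kernel,
    adjoint_compositionOperator_kernel, hC, hA, hA]

/-- Inner products of kernels are exponentials of inner products of points, so the common component
`s • ζ` contributes the same factor `exp(α‖s‖²)` to all four terms. -/
theorem norm_kernel_sub_kernel_sq {ζ x y : EuclideanSpace ℂ (Fin n)} (hζ : ‖ζ‖ = 1)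
    (hx : inner ℂ ζ x = 0) (hy : inner ℂ ζ y = 0) (s : ℂ) :
    ‖kernel α (s • ζ + x) - kernel α (s • ζ + y)‖ ^ 2
      = Real.exp (α * ‖s‖ ^ 2) * ‖kernel α x - kernel α y‖ ^ 2 := by
  have hin : ∀ {x y : EuclideanSpace ℂ (Fin n)}, inner ℂ ζ x = 0 → inner ℂ ζ y = 0 →
      inner ℂ (kernel α (s • ζ + x)) (kernel α (s • ζ + y))
        = (Real.exp (α * ‖s‖ ^ 2) : ℝ) * inner ℂ (kernel α x) (kernel α y) := by
    intro x y hx hy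
    have hy' : inner ℂ y ζ = 0 := inner_eq_zero_symm.1 hy
    rw [inner_kernel_kernel, inner_kernel_kernel, inner_add_left, inner_add_right,
      inner_add_right, inner_smul_left, inner_smul_left, inner_smul_right, inner_smul_right,
      hx, hy', inner_self_eq_norm_sq_to_K, hζ, Complex.ofReal_exp, ← Complex.exp_add]
    have h1 : starRingEnd ℂ s * s = (‖s‖ : ℂ) ^ 2 := RCLike.conj_mul s
    congr 1
    push_cast
    rw [← h1]
    simp
    ring
  have h : inner ℂ (kernel α (s • ζ + x) - kernel α (s • ζ + y))
      (kernel α (s • ζ + x) - kernel α (s • ζ + y)) = (Real.exp (α * ‖s‖ ^ 2) : ℝ) *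
        inner ℂ (kernel α x - kernel α y) (kernel α x - kernel α y) := by
    rw [inner_sub_left, inner_sub_right, inner_sub_right, hin hx hx, hin hx hy, hin hy hx,
      hin hy hy, inner_sub_left, inner_sub_right, inner_sub_right]
    ring
  rw [inner_self_eq_norm_sq_to_K, inner_self_eq_norm_sq_to_K] at h
  simp only [Complex.coe_algebraMap] at h
  exact_mod_cast h

theorem selfCommutator_eq_zero_of_isEssentiallyNormal (hb : IsBoundedComposition α φ)
    {A : EuclideanSpace ℂ (Fin n) →L[ℂ] EuclideanSpace ℂ (Fin n)}
    (hA : ∀ z, φ z = A z) (hS : IsEssentiallyNormal (compositionOperator hb))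
    {ζ : EuclideanSpace ℂ (Fin n)} (hζ : ‖ζ‖ = 1)
    (h1 : ContinuousLinearMap.adjoint A (A ζ) = ζ)
    (h2 : A (ContinuousLinearMap.adjoint A ζ) = ζ) :
    ContinuousLinearMap.adjoint (compositionOperator hb) ∘L
      compositionOperator hb - compositionOperator hb ∘L
      ContinuousLinearMap.adjoint (compositionOperator hb) = 0 := by
  rw [IsEssentiallyNormal] at hS
  set S := ContinuousLinearMap.adjoint (compositionOperator hb) ∘L
      compositionOperator hb - compositionOperator hb ∘L
      ContinuousLinearMap.adjoint (compositionOperator hb) with hSdef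
  have hnorm : ∀ (s : ℂ) {v : EuclideanSpace ℂ (Fin n)}, inner ℂ ζ v = 0 →
      ‖S (kernel α (s • ζ + v))‖ ^ 2 = Real.exp (α * ‖s‖ ^ 2) * ‖S (kernel α v)‖ ^ 2 := by
    intro s v hv
    rw [hSdef, selfCommutator_kernel hb hA, selfCommutator_kernel hb hA]
    simp only [map_add, map_smul, h1, h2]
    refine norm_kernel_sub_kernel_sq hζ ?_ ?_ s
    -- A self-adjoint map fixing `ζ` preserves the orthogonal complement of `ζ`; this is used for
    -- `AA*` and then for `A*A`.
    · rw [← ContinuousLinearMap.adjoint_inner_left, ContinuousLinearMap.adjoint_inner_right, h2]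
      exact hv
    · rw [ContinuousLinearMap.adjoint_inner_right, ← ContinuousLinearMap.adjoint_inner_left, h1]
      exact hv
  have hzero : ∀ {v : EuclideanSpace ℂ (Fin n)}, inner ℂ ζ v = 0 → S (kernel α v) = 0 := by
    intro v hv
    have hsq : ∀ k : ℕ, ‖((k : ℝ) : ℂ) • ζ + v‖ ^ 2 = (k : ℝ) ^ 2 + ‖v‖ ^ 2 := fun k ↦ by
      have hv' : inner ℂ v ζ = 0 := inner_eq_zero_symm.1 hv
      rw [norm_add_sq_complex, inner_smul_right, hv', norm_smul, hζ]
      simp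
    have hw : Filter.Tendsto (fun k : ℕ ↦ ‖((k : ℝ) : ℂ) • ζ + v‖) Filter.atTop
        Filter.atTop := by
      refine Filter.tendsto_atTop_mono (fun k ↦ ?_) tendsto_natCast_atTop_atTop
      refine abs_le_of_sq_le_sq' ?_ (norm_nonneg _) |>.2
      rw [hsq]
      linarith [sq_nonneg ‖v‖]
    have h := tendsto_normalized_kernel hS hw
    -- The growth factor `exp(αk²)` from `hnorm` exactly cancels the normalization, so a sequence
    -- tending to zero is constant.
    have hconst : ∀ k : ℕ, Real.exp (-(α * ‖((k : ℝ) : ℂ) • ζ + v‖ ^ 2)) *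
        ‖S (kernel α (((k : ℝ) : ℂ) • ζ + v))‖ ^ 2
          = Real.exp (-(α * ‖v‖ ^ 2)) * ‖S (kernel α v)‖ ^ 2 := fun k ↦ by
      rw [hnorm _ hv, hsq, ← mul_assoc, ← Real.exp_add, Complex.norm_real, Real.norm_eq_abs,
        sq_abs]
      congr 2
      ring
    simp only [hconst] at h
    have h3 := tendsto_nhds_unique tendsto_const_nhds h
    simpa using h3
  have hker : ∀ w, S (kernel α w) = 0 := by
    intro w
    have hv : inner ℂ ζ (w - inner ℂ ζ w • ζ) = 0 := by
      rw [inner_sub_right, inner_smul_right, inner_self_eq_norm_sq_to_K, hζ]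
      simp
    have h3 := hnorm (inner ℂ ζ w) hv
    rw [hzero hv, add_sub_cancel] at h3
    simpa using h3
  refine ContinuousLinearMap.ext_on dense_span_range_kernel ?_
  rintro _ ⟨w, rfl⟩
  simpa using hker w

end Composition

end FockSpace

/-! ### The equivalence. -/

open FockSpace in
theorem theorem3p3 (n : ℕ) (α : ℝ) [Fact (0 < α)]
    (φ : EuclideanSpace ℂ (Fin n) → EuclideanSpace ℂ (Fin n)) (hφ : Differentiable ℂ φ)
    (hb : IsBoundedComposition α φ) :
    IsEssentiallyNormal (compositionOperator hb) ↔
      (IsCompactOperator (compositionOperator hb) ∨ IsStarNormal (compositionOperator hb)) := by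
  constructor
  · intro hS
    obtain ⟨A, b, hA, hA1, hAb⟩ := exists_affine hφ hb
    rcases hA1.lt_or_eq with hlt | heq
    · exact Or.inl (isCompactOperator_compositionOperator_of_lt_one hb hA hlt)
    right
    -- In finite dimension the norm is attained on the compact unit ball, and `‖A‖ = 1` forces the
    -- maximizer to be a unit vector.
    obtain ⟨ζ, hζ, hAζ⟩ : ∃ ζ, ‖ζ‖ = 1 ∧ ‖A ζ‖ = 1 := by
      obtain ⟨x, hx, hmax⟩ := (isCompact_closedBall (0 : EuclideanSpace ℂ (Fin n)) 1).exists_isMaxOn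
        ⟨0, by simp⟩ A.continuous.norm.continuousOn
      have hx1 : ‖x‖ ≤ 1 := by simpa using hx
      have h1 : 1 ≤ ‖A x‖ := by
        rw [← heq]
        refine ContinuousLinearMap.opNorm_le_of_unit_norm (norm_nonneg _) fun z hz ↦ ?_
        exact hmax (by simp [hz])
      have h2 : ‖A x‖ ≤ ‖x‖ := by simpa [heq] using A.le_opNorm x
      exact ⟨x, by linarith, by linarith⟩
    obtain ⟨hAdj, rfl⟩ := norm_adjoint_apply_of_isEssentiallyNormal hb hA hS hζ hAζ
      (hAb ζ (hAζ.trans hζ.symm))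
    have h1 := adjoint_apply_self_of_norm_eq hA1 (hAζ.trans hζ.symm)
    have h2 := adjoint_apply_self_of_norm_eq (T := ContinuousLinearMap.adjoint A)
      (by rwa [LinearIsometryEquiv.norm_map]) (hAdj.trans hζ.symm)
    rw [ContinuousLinearMap.adjoint_adjoint] at h2
    exact ⟨sub_eq_zero.1 (selfCommutator_eq_zero_of_isEssentiallyNormal hb
      (by simpa using hA) hS hζ h1 h2)⟩
  · rintro (hC | hN)
    · have h1 := hC.clm_comp (ContinuousLinearMap.adjoint (compositionOperator hb))
      have h2 := hC.comp_clm (ContinuousLinearMap.adjoint (compositionOperator hb))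
      exact h1.sub h2
    · have h : ContinuousLinearMap.adjoint (compositionOperator hb) ∘L compositionOperator hb
          - compositionOperator hb ∘L ContinuousLinearMap.adjoint (compositionOperator hb) = 0 :=
        sub_eq_zero.2 hN.star_comm_self
      rw [IsEssentiallyNormal, h]
      exact isCompactOperator_zero

end
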